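/- Let $\mathbb K$ be an algebraically closed field of characteristic $0$ and let $\mathfrak q$ be a finite-dimensional Lie algebra over $\mathbb K$. Let $\mathfrak q[t,t^{-1}]=\mathfrak q\otimes_{\mathbb K}\mathbb K[t,t^{-1}]$ be its loop algebra, with bracket $[xt^m,yt^n]=[x,y]t^{m+n}$, and let $\mathfrak q[t]$, $\mathfrak q[t^{-1}]$ be the Lie subalgebras of polynomials in $t$, respectively in $t^{-1}$. Identify $\mathfrak q[t]$ as a vector space with the quotient $\mathfrak q[t,t^{-1}]/t^{-1}\mathfrak q[t^{-1}]$; thus $\mathfrak q[t^{-1}]$ acts on $\mathfrak q[t]$ by $y\cdot v=[y,v] \bmod t^{-1}\mathfrak q[t^{-1}]$, and hence acts by derivations on the symmetric algebra $\mathcal S(\mathfrak q[t])$. Let $$\mathcal Z(\widehat{\mathfrak q},[0])=\mathcal S(\mathfrak q[t])^{\mathfrak q[t^{-1}]}\subset \mathcal S(\mathfrak q[t])$$ be the subalgebra of elements annihilated by every $y\in\mathfrak q[t^{-1}]$. Equip $\mathcal S(\mathfrak q[t])$ with its Poisson bracket, i.e. the biderivation $\{\,,\}$ with $\{v,w\}=[v,w]$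 for $v,w\in\mathfrak q[t]$. Then $\mathcal Z(\widehat{\mathfrak q},[0])$ is Poisson-commutative: $\{F,G\}=0$ for all $F,G\in\mathcal Z(\widehat{\mathfrak q},[0])$. -/

import Mathlib

open scoped TensorProduct

noncomputable section

/-! ### Derivations of a symmetric algebra and the Lie-Poisson bracket -/

namespace LiePoisson

section Derivations

variable {R M : Type*} [CommRing R] [AddCommGroup M] [Module R M]

/-- The algebra map `S(M) → S(M)[ε]` sending `x ∈ M` to `x + ε f(x)`. -/
def dualLift (f : M →ₗ[R] SymmetricAlgebra R M) :
    SymmetricAlgebra R M →ₐ[R] DualNumber (SymmetricAlgebra R M) :=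
  SymmetricAlgebra.lift
    ((TrivSqZeroExt.inlAlgHom R (SymmetricAlgebra R M) (SymmetricAlgebra R M)).toLinearMap ∘ₗ
        SymmetricAlgebra.ι R M +
      (TrivSqZeroExt.inrHom (SymmetricAlgebra R M) (SymmetricAlgebra R M)).restrictScalars R ∘ₗ f)

theorem fst_dualLift (f : M →ₗ[R] SymmetricAlgebra R M) (a : SymmetricAlgebra R M) :
    (dualLift f a).fst = a := by
  have h : (TrivSqZeroExt.fstHom R (SymmetricAlgebra R M) (SymmetricAlgebra R M)).comp
      (dualLift f) = AlgHom.id R _ := by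
    apply SymmetricAlgebra.algHom_ext
    ext x
    simp [dualLift]
  exact congrArg (fun g => g a) h

/-- The unique `R`-linear derivation of `S(M)` that restricts to `f` on `M`. -/
def derivOf (f : M →ₗ[R] SymmetricAlgebra R M) :
    Derivation R (SymmetricAlgebra R M) (SymmetricAlgebra R M) :=
  Derivation.mk'
    ((TrivSqZeroExt.sndHom (SymmetricAlgebra R M) (SymmetricAlgebra R M)).restrictScalars R ∘ₗ
      (dualLift f).toLinearMap)
    (fun a b => by simp [fst_dualLift, mul_comm])

@[simp]
theorem derivOf_ι (f : M →ₗ[R] SymmetricAlgebra R M) (x : M) :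
    derivOf f (SymmetricAlgebra.ι R M x) = f x := by
  simp [derivOf, dualLift]

theorem derivation_ext {D₁ D₂ : Derivation R (SymmetricAlgebra R M) (SymmetricAlgebra R M)}
    (h : ∀ x, D₁ (SymmetricAlgebra.ι R M x) = D₂ (SymmetricAlgebra.ι R M x)) : D₁ = D₂ := by
  ext a
  induction a using SymmetricAlgebra.induction with
  | algebraMap r => simp
  | ι x => exact h x
  | mul a b ha hb => simp [ha, hb]
  | add a b ha hb => simp [ha, hb]

/-- The derivation of `S(M)` extending an endomorphism `φ` of `M`; this is the usual action of
`φ ∈ 𝔤𝔩(M)` on `S(M)`. -/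
def symAction (φ : Module.End R M) :
    Derivation R (SymmetricAlgebra R M) (SymmetricAlgebra R M) :=
  derivOf (SymmetricAlgebra.ι R M ∘ₗ φ)

@[simp]
theorem symAction_ι (φ : Module.End R M) (x : M) :
    symAction φ (SymmetricAlgebra.ι R M x) = SymmetricAlgebra.ι R M (φ x) := by
  simp [symAction]

end Derivations

section Bracket

variable (R L : Type*) [CommRing R] [LieRing L] [LieAlgebra R L]

/-- For `G ∈ S(L)`, the linear map `L → S(L)`, `x ↦ {x, G} = (ad x)·G`. -/
def adApply (G : SymmetricAlgebra R L) : L →ₗ[R] SymmetricAlgebra R L where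
  toFun x := symAction (LieAlgebra.ad R L x) G
  map_add' x y := by
    have h : symAction (LieAlgebra.ad R L (x + y)) =
        symAction (LieAlgebra.ad R L x) + symAction (LieAlgebra.ad R L y) :=
      derivation_ext fun z => by simp
    rw [h, Derivation.add_apply]
  map_smul' r x := by
    have h : symAction (LieAlgebra.ad R L (r • x)) = r • symAction (LieAlgebra.ad R L x) :=
      derivation_ext fun z => by simp
    rw [h, Derivation.smul_apply, RingHom.id_apply]

/-- The Poisson bracket of the symmetric algebra `S(L)` of a Lie algebra `L`: the biderivation with
`{x, y} = [x, y]` for `x, y ∈ L`. -/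
def poissonBracket (F G : SymmetricAlgebra R L) : SymmetricAlgebra R L :=
  derivOf (adApply R L G) F

theorem poissonBracket_ι_left (x : L) (G : SymmetricAlgebra R L) :
    poissonBracket R L (SymmetricAlgebra.ι R L x) G = symAction (LieAlgebra.ad R L x) G := by
  simp [poissonBracket, adApply]

theorem poissonBracket_ι_ι (x y : L) :
    poissonBracket R L (SymmetricAlgebra.ι R L x) (SymmetricAlgebra.ι R L y) =
      SymmetricAlgebra.ι R L ⁅x, y⁆ := by
  simp [poissonBracket_ι_left]

theorem poissonBracket_mul_left (F₁ F₂ G : SymmetricAlgebra R L) :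
    poissonBracket R L (F₁ * F₂) G =
      F₁ * poissonBracket R L F₂ G + F₂ * poissonBracket R L F₁ G := by
  simp [poissonBracket]

theorem poissonBracket_add_left (F₁ F₂ G : SymmetricAlgebra R L) :
    poissonBracket R L (F₁ + F₂) G = poissonBracket R L F₁ G + poissonBracket R L F₂ G := by
  simp [poissonBracket]

theorem poissonBracket_smul_left (r : R) (F G : SymmetricAlgebra R L) :
    poissonBracket R L (r • F) G = r • poissonBracket R L F G := by
  simp [poissonBracket]

theorem poissonBracket_skew (F G : SymmetricAlgebra R L) :
    poissonBracket R L F G = -poissonBracket R L G F := by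
  induction F using SymmetricAlgebra.induction with
  | algebraMap r =>
    have h : derivOf (adApply R L (algebraMap R (SymmetricAlgebra R L) r)) = 0 :=
      derivation_ext fun x => by simp [adApply]
    simp [poissonBracket, h]
  | ι x =>
    rw [poissonBracket_ι_left]
    have h : symAction (LieAlgebra.ad R L x) =
        -derivOf (adApply R L (SymmetricAlgebra.ι R L x)) :=
      derivation_ext fun y => by
        simp only [symAction_ι, LieAlgebra.ad_apply, Derivation.neg_apply, derivOf_ι, adApply,
          LinearMap.coe_mk, AddHom.coe_mk]
        rw [← lie_skew, map_neg]
    rw [h, Derivation.neg_apply, poissonBracket]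
  | mul a b ha hb =>
    have h : derivOf (adApply R L (a * b)) =
        a • derivOf (adApply R L b) + b • derivOf (adApply R L a) :=
      derivation_ext fun x => by simp [adApply]
    rw [poissonBracket_mul_left, ha, hb, poissonBracket, poissonBracket, poissonBracket, h]
    simp only [Derivation.add_apply, Derivation.smul_apply, smul_eq_mul]
    ring
  | add a b ha hb =>
    have h : derivOf (adApply R L (a + b)) =
        derivOf (adApply R L a) + derivOf (adApply R L b) :=
      derivation_ext fun x => by simp [adApply]
    rw [poissonBracket_add_left, ha, hb, poissonBracket, poissonBracket, poissonBracket, h]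
    simp only [Derivation.add_apply]
    ring

end Bracket

end LiePoisson

/-! ### The loop algebra `𝔮[t, t⁻¹]` and the invariants `S(𝔮[t])^{𝔮[t⁻¹]}` -/

namespace LoopInvariants

open LieAlgebra LiePoisson

variable (K q : Type*) [Field K] [LieRing q] [LieAlgebra K q]

/-- The subspace `⊕_{n ∈ s} 𝔮 tⁿ` of the loop algebra `𝔮[t, t⁻¹] = K[t, t⁻¹] ⊗ 𝔮`. -/
def degPart (s : Set ℤ) : Submodule K (loopAlgebra K ℤ q) :=
  (Finsupp.supported q K s).comap (LoopAlgebra.toFinsupp K ℤ q).toLinearMap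

theorem degPart_eq_span (s : Set ℤ) :
    degPart K q s = Submodule.span K
      {z | ∃ n ∈ s, ∃ x : q, z = (AddMonoidAlgebra.single n (1 : K)) ⊗ₜ[K] x} := by
  have h1 : degPart K q s = (Finsupp.supported q K s).map
      (LoopAlgebra.toFinsupp K ℤ q).symm.toLinearMap := by
    ext z
    constructor
    · intro hz
      exact ⟨_, hz, (LoopAlgebra.toFinsupp K ℤ q).symm_apply_apply z⟩
    · rintro ⟨w, hw, rfl⟩
      simpa [degPart] using hw
  apply le_antisymm
  · rw [h1, Submodule.map_le_iff_le_comap]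
    intro w hw
    rw [Submodule.mem_comap, ← Finsupp.sum_single w, Finsupp.sum, map_sum]
    refine Submodule.sum_mem _ fun n hn => Submodule.subset_span ⟨n, hw hn, w n, ?_⟩
    exact LoopAlgebra.toFinsupp_symm_single K ℤ q n (w n)
  · rw [Submodule.span_le]
    rintro _ ⟨n, hn, x, rfl⟩
    change LoopAlgebra.toFinsupp K ℤ q _ ∈ Finsupp.supported q K s
    rw [LoopAlgebra.toFinsupp_single_tmul]
    exact Finsupp.single_mem_supported K x hn

theorem lie_mem_degPart {s t u : Set ℤ} (h : ∀ m ∈ s, ∀ n ∈ t, m + n ∈ u)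
    {z w : loopAlgebra K ℤ q} (hz : z ∈ degPart K q s) (hw : w ∈ degPart K q t) :
    LieAlgebra.ad K (loopAlgebra K ℤ q) z w ∈ degPart K q u := by
  rw [degPart_eq_span] at hz hw ⊢
  induction hz using Submodule.span_induction with
  | zero => rw [map_zero, LinearMap.zero_apply]; exact zero_mem _
  | add a b _ _ ha hb => rw [map_add, LinearMap.add_apply]; exact add_mem ha hb
  | smul r a _ ha => rw [map_smul, LinearMap.smul_apply]; exact Submodule.smul_mem _ r ha
  | mem a ha =>
    obtain ⟨m, hm, x, rfl⟩ := ha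
    induction hw using Submodule.span_induction with
    | zero => rw [map_zero]; exact zero_mem _
    | add a b _ _ ha hb => rw [map_add]; exact add_mem ha hb
    | smul r a _ ha => rw [map_smul]; exact Submodule.smul_mem _ r ha
    | mem b hb =>
      obtain ⟨n, hn, y, rfl⟩ := hb
      refine Submodule.subset_span ⟨m + n, h m hm n hn, ⁅x, y⁆, ?_⟩
      rw [LieAlgebra.ad_apply]
      refine (ExtendScalars.bracket_tmul K (AddMonoidAlgebra K ℤ) q q _ _ x y).trans ?_
      rw [AddMonoidAlgebra.single_mul_single, one_mul]

/-- The current algebra `𝔮[t]`, a Lie subalgebra of `𝔮[t, t⁻¹]`. -/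
def currentAlg : LieSubalgebra K (loopAlgebra K ℤ q) where
  __ := degPart K q (Set.Ici 0)
  lie_mem' hx hy := lie_mem_degPart K q (fun m hm n hn => show 0 ≤ m + n from add_nonneg hm hn) hx hy

/-- The Lie subalgebra `𝔮[t⁻¹]` of `𝔮[t, t⁻¹]`. -/
def negCurrentAlg : LieSubalgebra K (loopAlgebra K ℤ q) where
  __ := degPart K q (Set.Iic 0)
  lie_mem' hx hy := lie_mem_degPart K q (fun m hm n hn => show m + n ≤ 0 from add_nonpos hm hn) hx hy

/-- The subspace `t⁻¹𝔮[t⁻¹]` of `𝔮[t, t⁻¹]`. -/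
def strictNeg : Submodule K (loopAlgebra K ℤ q) := degPart K q (Set.Iio 0)

theorem isCompl_currentAlg_strictNeg :
    IsCompl (currentAlg K q).toSubmodule (strictNeg K q) := by
  have h : IsCompl (Set.Ici (0 : ℤ)) (Set.Iio 0) := by
    rw [← Set.compl_Ici]; exact isCompl_compl
  constructor
  · rw [Submodule.disjoint_def]
    intro z hz hz'
    have := (Submodule.disjoint_def.1 (Finsupp.disjoint_supported_supported
      (M := q) (R := K) h.disjoint)) _ hz hz'
    simpa using this
  · rw [Submodule.codisjoint_iff_exists_add_eq]
    intro z
    obtain ⟨a, b, ha, hb, hab⟩ := (Submodule.codisjoint_iff_exists_add_eq.1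
      (Finsupp.codisjoint_supported_supported (M := q) (R := K) h.codisjoint))
      (LoopAlgebra.toFinsupp K ℤ q z)
    refine ⟨(LoopAlgebra.toFinsupp K ℤ q).symm a, (LoopAlgebra.toFinsupp K ℤ q).symm b,
      ?_, ?_, ?_⟩
    · change LoopAlgebra.toFinsupp K ℤ q _ ∈ Finsupp.supported q K _
      simpa using ha
    · change LoopAlgebra.toFinsupp K ℤ q _ ∈ Finsupp.supported q K _
      simpa using hb
    · rw [← map_add, hab, LinearEquiv.symm_apply_apply]

/-- The projection `𝔮[t, t⁻¹] → 𝔮[t]` along `t⁻¹𝔮[t⁻¹]`, i.e. the identification of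
`𝔮[t, t⁻¹] / t⁻¹𝔮[t⁻¹]` with `𝔮[t]` composed with the quotient map. -/
def projCurrent : loopAlgebra K ℤ q →ₗ[K] currentAlg K q :=
  (currentAlg K q).toSubmodule.projectionOnto (strictNeg K q) (isCompl_currentAlg_strictNeg K q)

theorem projCurrent_eq_zero {z : loopAlgebra K ℤ q} (hz : z ∈ strictNeg K q) :
    projCurrent K q z = 0 :=
  (Submodule.projectionOnto_apply_eq_zero_iff (isCompl_currentAlg_strictNeg K q)).2 hz

theorem sub_projCurrent_mem (z : loopAlgebra K ℤ q) :
    z - (projCurrent K q z : loopAlgebra K ℤ q) ∈ strictNeg K q := by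
  rw [← Submodule.projectionOnto_apply_eq_zero_iff (isCompl_currentAlg_strictNeg K q), map_sub,
    sub_eq_zero]
  exact (Submodule.projectionOnto_apply_left (isCompl_currentAlg_strictNeg K q) _).symm

/-- The action of `y ∈ 𝔮[t⁻¹]` on `𝔮[t] ≅ 𝔮[t, t⁻¹] / t⁻¹𝔮[t⁻¹]`: the endomorphism
`v ↦ [y, v] mod t⁻¹𝔮[t⁻¹]` of `𝔮[t]`. -/
def currentAction (y : negCurrentAlg K q) : Module.End K (currentAlg K q) :=
  projCurrent K q ∘ₗ (LieAlgebra.ad K (loopAlgebra K ℤ q) (y : loopAlgebra K ℤ q)) ∘ₗ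
    (currentAlg K q).toSubmodule.subtype

theorem currentAction_apply (y : negCurrentAlg K q) (v : currentAlg K q) :
    currentAction K q y v =
      projCurrent K q (LieAlgebra.ad K (loopAlgebra K ℤ q) y v) := rfl

theorem projCurrent_ad_projCurrent (y : negCurrentAlg K q) (z : loopAlgebra K ℤ q) :
    projCurrent K q (LieAlgebra.ad K (loopAlgebra K ℤ q) y (projCurrent K q z)) =
      projCurrent K q (LieAlgebra.ad K (loopAlgebra K ℤ q) y z) := by
  have h : LieAlgebra.ad K (loopAlgebra K ℤ q) y (z - (projCurrent K q z : loopAlgebra K ℤ q)) ∈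
      strictNeg K q :=
    lie_mem_degPart K q
      (fun m hm n hn => show m + n < 0 from add_neg_of_nonpos_of_neg hm hn) y.2
      (sub_projCurrent_mem K q z)
  have h' := projCurrent_eq_zero K q h
  rw [map_sub, map_sub, sub_eq_zero] at h'
  exact h'.symm

/-- The endomorphisms `currentAction K q y` form a representation of the Lie algebra `𝔮[t⁻¹]`. -/
theorem currentAction_lie (x y : negCurrentAlg K q) :
    currentAction K q ⁅x, y⁆ =
      currentAction K q x * currentAction K q y - currentAction K q y * currentAction K q x := by
  ext1 v
  rw [LinearMap.sub_apply, Module.End.mul_apply, Module.End.mul_apply]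
  simp only [currentAction_apply, projCurrent_ad_projCurrent]
  rw [← map_sub]
  congr 1
  exact lie_lie (x : loopAlgebra K ℤ q) (y : loopAlgebra K ℤ q) (v : loopAlgebra K ℤ q)

/-- The algebra of invariants `S(𝔮[t])^{𝔮[t⁻¹]}`, where `𝔮[t⁻¹]` acts on `S(𝔮[t])` by the
derivations extending its action on `𝔮[t] ≅ 𝔮[t, t⁻¹] / t⁻¹𝔮[t⁻¹]`. -/
def invariants : Subalgebra K (SymmetricAlgebra K (currentAlg K q)) where
  carrier := {F | ∀ y : negCurrentAlg K q, symAction (currentAction K q y) F = 0}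
  mul_mem' ha hb y := by simp [ha y, hb y]
  add_mem' ha hb y := by simp [ha y, hb y]
  algebraMap_mem' r y := by simp

end LoopInvariants

end

noncomputable section

open scoped Matrix PowerSeries

/-! ### Generalized inverses and divisibility of bilinear forms over power series -/

section GeneralizedInverse

/-! Fix a basis `b` of `q` and encode everything over `S(𝔮[t])⟦X⟧`. Let `M` have entries `∑ₖ [bᵢ,
bⱼ]tᵏ Xᵏ`, and let `u_F` be the gradient of `F` with `∂F/∂(bᵢtᵃ)` placed at `Xⁿ⁻ᵃ`, where `n` bounds
the degrees in `t` of the variables in `F` and `G`. For `p ≤ n`, the `Xᵖ` coefficient of `(M u_F)ᵢ`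
is the action of `bᵢ t⁻⁽ⁿ⁻ᵖ⁾` on `F`, so invariance gives `Xⁿ⁺¹ ∣ M u_F`, and likewise for `G`. The
bracket `{F, G}` is the `X²ⁿ` coefficient of `u_Fᵀ M u_G`.

If `M` were invertible, `u_Fᵀ M u_G = (u_Fᵀ M) M⁻¹ (M u_G)` would be divisible by `X²ⁿ⁺²` and the
bracket would vanish. In general `M` is singular, but it is the image of the Lie-Poisson matrix over
the domain `S(𝔮)`, which satisfies `A P A = f A` with `f ≠ 0`. The map `x ↦ ∑ₙ (x tⁿ) Xⁿ` carries
this identity to `M` and sends `f` to a series with nonzero constant term. That series is prime to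
`X`, so it can be cancelled from the divisibility. -/

/-- Every linear map between vector spaces has a generalized inverse. -/
theorem LinearMap.exists_comp_comp_eq_self {E V W : Type*} [Field E] [AddCommGroup V] [Module E V]
    [AddCommGroup W] [Module E W] (f : V →ₗ[E] W) : ∃ g : W →ₗ[E] V, f ∘ₗ g ∘ₗ f = f := by
  -- The generalized inverse is a section of `V → range f`, extended linearly to all of `W`.
  obtain ⟨h, hh⟩ := f.rangeRestrict.exists_rightInverse_of_surjective f.range_rangeRestrict
  obtain ⟨g, hg⟩ := LinearMap.exists_extend h
  refine ⟨g, LinearMap.ext fun v => ?_⟩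
  have h1 : g (f v) = h (f.rangeRestrict v) := (LinearMap.congr_fun hg (f.rangeRestrict v) :)
  have h2 := congrArg Subtype.val (LinearMap.congr_fun hh (f.rangeRestrict v))
  simpa [h1] using h2

theorem Matrix.exists_mul_mul_eq_self {E ι : Type*} [Field E] [Fintype ι]
    (A : Matrix ι ι E) : ∃ P : Matrix ι ι E, A * P * A = A := by
  classical
  obtain ⟨g, hg⟩ := LinearMap.exists_comp_comp_eq_self (Matrix.toLin' A)
  refine ⟨LinearMap.toMatrix' g, ?_⟩
  apply Matrix.toLin'.injective
  rw [Matrix.toLin'_mul, Matrix.toLin'_mul, Matrix.toLin'_toMatrix', LinearMap.comp_assoc, hg]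

/-- A square matrix over a domain has a generalized inverse up to a nonzero denominator. -/
theorem Matrix.exists_mul_mul_eq_smul {R ι : Type*} [CommRing R] [IsDomain R] [Fintype ι]
    (A : Matrix ι ι R) : ∃ f : R, f ≠ 0 ∧ ∃ P : Matrix ι ι R, A * P * A = f • A := by
  classical
  let E := FractionRing R
  obtain ⟨P, hP⟩ := Matrix.exists_mul_mul_eq_self (A.map (algebraMap R E))
  -- A common denominator of the entries of the generalized inverse over the fraction field; it
  -- becomes `f`.
  obtain ⟨b, hb⟩ := IsLocalization.exist_integer_multiples_of_finite (nonZeroDivisors R)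
    (fun ij : ι × ι => P ij.1 ij.2)
  choose Q hQ using hb
  refine ⟨b, nonZeroDivisors.coe_ne_zero b, Matrix.of fun i j => Q (i, j), ?_⟩
  apply Matrix.map_injective (IsFractionRing.injective R E)
  have hQ' : (Matrix.of fun i j => Q (i, j)).map (algebraMap R E) = algebraMap R E b • P := by
    ext i j
    simpa [Algebra.smul_def] using hQ (i, j)
  beta_reduce
  rw [Matrix.map_mul, Matrix.map_mul, hQ', Matrix.mul_smul, Matrix.smul_mul, hP]
  ext i j
  simp

theorem PowerSeries.X_pow_dvd_of_dvd_mul {S : Type*} [CommRing S] [IsDomain S] {f g : S⟦X⟧}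
    (hf : PowerSeries.constantCoeff f ≠ 0) {m : ℕ} (h : PowerSeries.X ^ m ∣ f * g) :
    PowerSeries.X ^ m ∣ g :=
  PowerSeries.X_prime.pow_dvd_of_dvd_mul_left m
    (fun hX => hf (PowerSeries.X_dvd_iff.1 hX)) h

/-- Inserting `P` splits `f * (u ⬝ᵥ M *ᵥ v)` into a form in `u ᵥ* M` and `M *ᵥ v`, so the two orders
of vanishing add up even when `M` is singular. Since `X` does not divide `f`, no order is lost on
cancelling `f`. -/
theorem Matrix.X_pow_dvd_dotProduct_mulVec {S ι : Type*} [CommRing S] [IsDomain S] [Fintype ι]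
    {M P : Matrix ι ι S⟦X⟧} {f : S⟦X⟧} (hf : PowerSeries.constantCoeff f ≠ 0)
    (hP : M * P * M = f • M) {u v : ι → S⟦X⟧} {m : ℕ}
    (hu : ∀ i, PowerSeries.X ^ m ∣ (u ᵥ* M) i) (hv : ∀ i, PowerSeries.X ^ m ∣ (M *ᵥ v) i) :
    PowerSeries.X ^ (m + m) ∣ u ⬝ᵥ M *ᵥ v := by
  apply PowerSeries.X_pow_dvd_of_dvd_mul hf
  have h : f * (u ⬝ᵥ M *ᵥ v) = (u ᵥ* M) ⬝ᵥ P *ᵥ (M *ᵥ v) := by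
    rw [← Matrix.dotProduct_mulVec, Matrix.mulVec_mulVec, Matrix.mulVec_mulVec, hP,
      Matrix.smul_mulVec, dotProduct_smul, smul_eq_mul]
  rw [h, pow_add]
  refine Finset.dvd_sum fun i _ => mul_dvd_mul (hu i) ?_
  exact Finset.dvd_sum fun j _ => (hv j).mul_left _

end GeneralizedInverse

namespace LoopInvariants

open LieAlgebra LiePoisson
open scoped Matrix PowerSeries

variable (K q : Type*) [Field K] [LieRing q] [LieAlgebra K q]

/-! ### Monomials of the loop algebra and the action of `𝔮[t⁻¹]` on them -/

/-- The element `x tⁿ` of the loop algebra. -/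
def loopMonomial (n : ℤ) : q →ₗ[K] loopAlgebra K ℤ q :=
  TensorProduct.mk K _ _ (AddMonoidAlgebra.single n 1)

theorem toFinsupp_loopMonomial (n : ℤ) (x : q) :
    LoopAlgebra.toFinsupp K ℤ q (loopMonomial K q n x) = Finsupp.single n x :=
  LoopAlgebra.toFinsupp_single_tmul K ℤ q n x

theorem loopMonomial_mem_degPart {s : Set ℤ} {n : ℤ} (hn : n ∈ s) (x : q) :
    loopMonomial K q n x ∈ degPart K q s := by
  change LoopAlgebra.toFinsupp K ℤ q _ ∈ Finsupp.supported q K s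
  rw [toFinsupp_loopMonomial]
  exact Finsupp.single_mem_supported K x hn

theorem ad_loopMonomial (m n : ℤ) (x y : q) :
    LieAlgebra.ad K (loopAlgebra K ℤ q) (loopMonomial K q m x) (loopMonomial K q n y) =
      loopMonomial K q (m + n) ⁅x, y⁆ := by
  rw [LieAlgebra.ad_apply]
  refine (ExtendScalars.bracket_tmul K (AddMonoidAlgebra K ℤ) q q _ _ x y).trans ?_
  rw [AddMonoidAlgebra.single_mul_single, one_mul]
  rfl

/-- The element `x tⁿ` of the current algebra. -/
def currentMonomial (n : ℕ) : q →ₗ[K] currentAlg K q :=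
  (loopMonomial K q n).codRestrict (currentAlg K q).toSubmodule
    fun x => loopMonomial_mem_degPart K q (s := Set.Ici 0) (Int.natCast_nonneg n) x

theorem coe_currentMonomial (n : ℕ) (x : q) :
    (currentMonomial K q n x : loopAlgebra K ℤ q) = loopMonomial K q n x := rfl

theorem lie_currentMonomial (m n : ℕ) (x y : q) :
    ⁅currentMonomial K q m x, currentMonomial K q n y⁆ = currentMonomial K q (m + n) ⁅x, y⁆ := by
  apply Subtype.ext
  rw [LieSubalgebra.coe_bracket]
  simp only [coe_currentMonomial]
  rw [← LieAlgebra.ad_apply (R := K), ad_loopMonomial, Nat.cast_add]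

/-- The coefficient of `tⁿ` of an element of the current algebra. -/
def currentCoeff (n : ℕ) : currentAlg K q →ₗ[K] q :=
  Finsupp.lapply (n : ℤ) ∘ₗ (LoopAlgebra.toFinsupp K ℤ q).toLinearMap ∘ₗ
    (currentAlg K q).toSubmodule.subtype

theorem currentCoeff_apply (n : ℕ) (v : currentAlg K q) :
    currentCoeff K q n v = LoopAlgebra.toFinsupp K ℤ q (v : loopAlgebra K ℤ q) n := rfl

theorem currentCoeff_currentMonomial (m n : ℕ) (x : q) :
    currentCoeff K q m (currentMonomial K q n x) = if m = n then x else 0 := by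
  rw [currentCoeff_apply, coe_currentMonomial, toFinsupp_loopMonomial, Finsupp.single_apply]
  simp [eq_comm]

theorem exists_sum_currentMonomial (v : currentAlg K q) :
    ∃ N₀ : ℕ, ∀ N ≥ N₀,
      v = ∑ a ∈ Finset.range N, currentMonomial K q a (currentCoeff K q a v) := by
  set w := LoopAlgebra.toFinsupp K ℤ q (v : loopAlgebra K ℤ q) with hw
  refine ⟨w.support.sup Int.toNat + 1, fun N hN => ?_⟩
  apply Subtype.ext
  apply (LoopAlgebra.toFinsupp K ℤ q).injective
  rw [AddSubmonoidClass.coe_finsetSum, map_sum]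
  -- From here on, coefficients in `ℤ`-degree are compared; those in negative degree vanish because
  -- `v` lies in `𝔮[t]`.
  simp only [coe_currentMonomial, toFinsupp_loopMonomial, currentCoeff_apply, ← hw]
  ext n
  rw [Finsupp.finsetSum_apply]
  simp only [Finsupp.single_apply]
  by_cases hn : n ∈ w.support
  · have h0 : 0 ≤ n := by
      have : w ∈ Finsupp.supported q K (Set.Ici 0) := v.2
      exact this hn
    have h1 : n.toNat ≤ w.support.sup Int.toNat := Finset.le_sup (f := Int.toNat) hn
    rw [Finset.sum_eq_single n.toNat]
    · simp [Int.toNat_of_nonneg h0]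
    · intro b _ hb
      rw [if_neg]
      omega
    · intro h
      simp only [Finset.mem_range, not_lt] at h
      omega
  · rw [Finsupp.notMem_support_iff.1 hn]
    refine (Finset.sum_eq_zero fun a _ => ?_).symm
    split_ifs with h
    · rw [h, Finsupp.notMem_support_iff.1 hn]
    · rfl

theorem projCurrent_loopMonomial_of_nonneg (n : ℕ) (x : q) :
    projCurrent K q (loopMonomial K q n x) = currentMonomial K q n x :=
  Submodule.projectionOnto_apply_left (isCompl_currentAlg_strictNeg K q) (currentMonomial K q n x)

theorem projCurrent_loopMonomial_of_neg {n : ℤ} (hn : n < 0) (x : q) :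
    projCurrent K q (loopMonomial K q n x) = 0 :=
  projCurrent_eq_zero K q (loopMonomial_mem_degPart K q (s := Set.Iio 0) hn x)

/-- The element `x t⁻ᵐ` of `𝔮[t⁻¹]`. -/
def negMonomial (m : ℕ) (x : q) : negCurrentAlg K q :=
  ⟨loopMonomial K q (-m) x, loopMonomial_mem_degPart K q (s := Set.Iic 0) (by simp) x⟩

theorem currentAction_negMonomial (m n : ℕ) (x y : q) :
    currentAction K q (negMonomial K q m x) (currentMonomial K q n y) =
      if m ≤ n then currentMonomial K q (n - m) ⁅x, y⁆ else 0 := by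
  rw [currentAction_apply, coe_currentMonomial, negMonomial, ad_loopMonomial]
  split_ifs with h
  · rw [← projCurrent_loopMonomial_of_nonneg]
    congr 3
    omega
  · exact projCurrent_loopMonomial_of_neg K q (by omega) _

/-! ### The universal arc `S(𝔮) → S(𝔮[t])⟦X⟧` -/

/-- The generator `x tⁿ` of `S(𝔮[t])`. -/
def gen (n : ℕ) : q →ₗ[K] SymmetricAlgebra K (currentAlg K q) :=
  SymmetricAlgebra.ι K (currentAlg K q) ∘ₗ currentMonomial K q n

/-- The homomorphism `S(𝔮) → S(𝔮[t])⟦X⟧` with `x ↦ ∑ₙ (x tⁿ) Xⁿ`. -/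
def arcHom : SymmetricAlgebra K q →ₐ[K] (SymmetricAlgebra K (currentAlg K q))⟦X⟧ :=
  SymmetricAlgebra.lift
    { toFun := fun x => PowerSeries.mk fun n => gen K q n x
      map_add' := fun x y => by ext n; simp
      map_smul' := fun r x => by ext n; simp }

theorem arcHom_ι (x : q) :
    arcHom K q (SymmetricAlgebra.ι K q x) = PowerSeries.mk fun n => gen K q n x := by
  simp [arcHom]

/-- The constant term is the embedding `S(𝔮) → S(𝔮[t])` induced by `x ↦ x t⁰`, and evaluation at `t
= 0` retracts it. This keeps the constant term of the transported denominator nonzero. -/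
theorem constantCoeff_arcHom_injective :
    Function.Injective fun f => PowerSeries.constantCoeff (arcHom K q f) := by
  let r : SymmetricAlgebra K (currentAlg K q) →ₐ[K] SymmetricAlgebra K q :=
    SymmetricAlgebra.lift (SymmetricAlgebra.ι K q ∘ₗ currentCoeff K q 0)
  have h : (r : SymmetricAlgebra K (currentAlg K q) →+* SymmetricAlgebra K q).comp
      (PowerSeries.constantCoeff.comp (arcHom K q : SymmetricAlgebra K q →+* _)) =
      RingHom.id _ := by
    refine RingHom.ext fun f => ?_
    induction f using SymmetricAlgebra.induction with
    | algebraMap c => simp [PowerSeries.algebraMap_apply]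
    | ι x => simp [arcHom_ι, gen, r, currentCoeff_currentMonomial]
    | mul a b ha hb => rw [map_mul, map_mul, ha, hb]
    | add a b ha hb => rw [map_add, map_add, ha, hb]
  exact Function.LeftInverse.injective (g := r) fun f => (RingHom.congr_fun h f :)

/-! ### Gradients, invariance and the bracket in coordinates -/

section Coordinates

variable {K q} {ι : Type*} (b : Module.Basis ι K q)

/-- The partial derivative of `S(𝔮[t])` with respect to the variable `bᵢ tᵃ`. -/
def partialDeriv (i : ι) (a : ℕ) :
    Derivation K (SymmetricAlgebra K (currentAlg K q)) (SymmetricAlgebra K (currentAlg K q)) :=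
  derivOf (Algebra.linearMap K _ ∘ₗ b.coord i ∘ₗ currentCoeff K q a)

variable (K q) in
/-- The matrix `(∑ₖ [bᵢ, bⱼ] tᵏ Xᵏ)ᵢⱼ` of the universal Lie-Poisson tensor on arcs. -/
def arcMatrix : Matrix ι ι (SymmetricAlgebra K (currentAlg K q))⟦X⟧ :=
  Matrix.of fun i j => PowerSeries.mk fun k => gen K q k ⁅b i, b j⁆

theorem arcMatrix_transpose : (arcMatrix K q b)ᵀ = -arcMatrix K q b := by
  ext i j k
  simp only [arcMatrix, Matrix.transpose_apply, Matrix.neg_apply, Matrix.of_apply,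
    PowerSeries.coeff_mk, map_neg]
  rw [← lie_skew, map_neg]

variable [Fintype ι]

/-- The chain rule: a derivation of `S(𝔮[t])` is determined by its values on the variables. -/
theorem exists_derivation_eq_sum (F : SymmetricAlgebra K (currentAlg K q)) :
    ∃ N₀ : ℕ, ∀ N ≥ N₀, ∀ D : Derivation K (SymmetricAlgebra K (currentAlg K q))
        (SymmetricAlgebra K (currentAlg K q)),
      D F = ∑ i, ∑ a ∈ Finset.range N, partialDeriv b i a F * D (gen K q a (b i)) := by
  induction F using SymmetricAlgebra.induction with
  | algebraMap r => exact ⟨0, fun N _ D => by simp⟩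
  | ι v =>
    obtain ⟨N₀, h⟩ := exists_sum_currentMonomial K q v
    refine ⟨N₀, fun N hN D => ?_⟩
    conv_lhs => rw [h N hN]
    rw [map_sum, map_sum, Finset.sum_comm]
    refine Finset.sum_congr rfl fun a _ => ?_
    change D (gen K q a (currentCoeff K q a v)) = _
    conv_lhs => rw [← b.sum_repr (currentCoeff K q a v)]
    rw [map_sum, map_sum]
    refine Finset.sum_congr rfl fun i _ => ?_
    rw [map_smul, D.map_smul, partialDeriv, derivOf_ι, Algebra.smul_def]
    rfl
  | mul x y hx hy =>
    obtain ⟨N₁, h₁⟩ := hx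
    obtain ⟨N₂, h₂⟩ := hy
    -- The cutoff depends on the polynomial only, not on `D`, and any larger one works; this also
    -- lets two polynomials share a cutoff.
    refine ⟨max N₁ N₂, fun N hN D => ?_⟩
    rw [D.leibniz, h₁ N (le_of_max_le_left hN) D, h₂ N (le_of_max_le_right hN) D]
    simp only [Derivation.leibniz, smul_eq_mul, Finset.mul_sum, ← Finset.sum_add_distrib]
    refine Finset.sum_congr rfl fun i _ => Finset.sum_congr rfl fun a _ => ?_
    ring
  | add x y hx hy =>
    obtain ⟨N₁, h₁⟩ := hx
    obtain ⟨N₂, h₂⟩ := hy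
    refine ⟨max N₁ N₂, fun N hN D => ?_⟩
    rw [map_add, h₁ N (le_of_max_le_left hN) D, h₂ N (le_of_max_le_right hN) D]
    simp only [map_add, add_mul, Finset.sum_add_distrib]

/-- The differential of `F`, with pole of order `n` cleared: `∑ₐ (∂F/∂(bᵢ tᵃ)) Xⁿ⁻ᵃ`. -/
def arcGradient (n : ℕ) (F : SymmetricAlgebra K (currentAlg K q)) :
    ι → (SymmetricAlgebra K (currentAlg K q))⟦X⟧ :=
  fun i => ∑ a ∈ Finset.range (n + 1),
    PowerSeries.C (partialDeriv b i a F) * PowerSeries.X ^ (n - a)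

theorem coeff_arcMatrix_mulVec (n p : ℕ) (F : SymmetricAlgebra K (currentAlg K q)) (i : ι) :
    PowerSeries.coeff p ((arcMatrix K q b *ᵥ arcGradient b n F) i) =
      ∑ j, ∑ a ∈ Finset.range (n + 1), partialDeriv b j a F *
        if n - a ≤ p then gen K q (p - (n - a)) ⁅b i, b j⁆ else 0 := by
  simp only [Matrix.mulVec, dotProduct, arcMatrix, arcGradient, Matrix.of_apply, map_sum,
    Finset.mul_sum]
  refine Finset.sum_congr rfl fun j _ => Finset.sum_congr rfl fun a _ => ?_
  rw [mul_left_comm, PowerSeries.coeff_C_mul, PowerSeries.coeff_mul_X_pow', PowerSeries.coeff_mk]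

/-- The coefficients of `X⁰, …, Xⁿ` are the derivatives of `F` along `bᵢ t⁻ⁿ, …, bᵢ t⁰`, all zero by
invariance. -/
theorem X_pow_dvd_arcMatrix_mulVec {n : ℕ} {F : SymmetricAlgebra K (currentAlg K q)}
    (hF : F ∈ invariants K q)
    (hn : ∀ D : Derivation K (SymmetricAlgebra K (currentAlg K q))
        (SymmetricAlgebra K (currentAlg K q)),
      D F = ∑ i, ∑ a ∈ Finset.range (n + 1), partialDeriv b i a F * D (gen K q a (b i))) (i : ι) :
    PowerSeries.X ^ (n + 1) ∣ (arcMatrix K q b *ᵥ arcGradient b n F) i := by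
  rw [PowerSeries.X_pow_dvd_iff]
  intro p hp
  rw [coeff_arcMatrix_mulVec]
  have h := hn (symAction (currentAction K q (negMonomial K q (n - p) (b i))))
  rw [hF] at h
  refine Eq.trans ?_ h.symm
  refine Finset.sum_congr rfl fun j _ => Finset.sum_congr rfl fun a ha => ?_
  rw [Finset.mem_range] at ha
  simp only [gen, LinearMap.comp_apply]
  rw [symAction_ι, currentAction_negMonomial]
  -- As `a, p ≤ n`, the condition `n - a ≤ p` is the same as `n - p ≤ a`: the terms absent from the
  -- product of series are exactly those killed modulo `t⁻¹𝔮[t⁻¹]`.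
  by_cases hap : n - a ≤ p
  · rw [if_pos hap, if_pos (by omega), show p - (n - a) = a - (n - p) by omega]
  · rw [if_neg hap, if_neg (by omega), map_zero]

/-- The denominator is cleared over `S(𝔮)` and only then transported by `arcHom`. Working directly
over `S(𝔮[t])⟦X⟧` would give no control of the constant term of `f`. -/
theorem exists_arcMatrix_mul_mul_eq_smul :
    ∃ f : (SymmetricAlgebra K (currentAlg K q))⟦X⟧, PowerSeries.constantCoeff f ≠ 0 ∧
      ∃ P, arcMatrix K q b * P * arcMatrix K q b = f • arcMatrix K q b := by
  obtain ⟨f, hf, P, hP⟩ := Matrix.exists_mul_mul_eq_smul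
    (Matrix.of fun i j => SymmetricAlgebra.ι K q ⁅b i, b j⁆)
  refine ⟨arcHom K q f, fun h => hf (constantCoeff_arcHom_injective K q ?_), P.map (arcHom K q), ?_⟩
  · simpa using h
  · have hM : arcMatrix K q b =
        (Matrix.of fun i j => SymmetricAlgebra.ι K q ⁅b i, b j⁆).map (arcHom K q) := by
      ext1 i j
      simp [arcMatrix, arcHom_ι]
    rw [hM, ← Matrix.map_mul, ← Matrix.map_mul, hP]
    ext1 i j
    simp

/-- The terms `∂F/∂(bᵢtᵃ) Xⁿ⁻ᵃ` and `∂G/∂(bⱼtᶜ) Xⁿ⁻ᶜ` leave exponent `a + c` for the matrix entry,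
whose coefficient there is `[bᵢ, bⱼ]tᵃ⁺ᶜ = [bᵢtᵃ, bⱼtᶜ]`. -/
theorem coeff_dotProduct_arcMatrix {n : ℕ} {F G : SymmetricAlgebra K (currentAlg K q)}
    (hF : ∀ D : Derivation K (SymmetricAlgebra K (currentAlg K q))
        (SymmetricAlgebra K (currentAlg K q)),
      D F = ∑ i, ∑ a ∈ Finset.range (n + 1), partialDeriv b i a F * D (gen K q a (b i)))
    (hG : ∀ D : Derivation K (SymmetricAlgebra K (currentAlg K q))
        (SymmetricAlgebra K (currentAlg K q)),
      D G = ∑ i, ∑ a ∈ Finset.range (n + 1), partialDeriv b i a G * D (gen K q a (b i))) :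
    PowerSeries.coeff (2 * n) (arcGradient b n F ⬝ᵥ arcMatrix K q b *ᵥ arcGradient b n G) =
      poissonBracket K (currentAlg K q) F G := by
  rw [poissonBracket, hF, dotProduct, map_sum]
  refine Finset.sum_congr rfl fun i _ => ?_
  rw [arcGradient, Finset.sum_mul, map_sum]
  refine Finset.sum_congr rfl fun a ha => ?_
  rw [Finset.mem_range] at ha
  rw [mul_assoc, PowerSeries.coeff_C_mul, mul_comm (PowerSeries.X ^ _),
    PowerSeries.coeff_mul_X_pow', if_pos (by omega), coeff_arcMatrix_mulVec]
  congr 1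
  change _ = poissonBracket K (currentAlg K q)
    (SymmetricAlgebra.ι K _ (currentMonomial K q a (b i))) G
  rw [poissonBracket_ι_left, hG]
  refine Finset.sum_congr rfl fun j _ => Finset.sum_congr rfl fun c hc => ?_
  rw [Finset.mem_range] at hc
  rw [if_pos (by omega), gen, gen, LinearMap.comp_apply, LinearMap.comp_apply, symAction_ι,
    LieAlgebra.ad_apply, lie_currentMonomial, show 2 * n - (n - a) - (n - c) = a + c by omega]

end Coordinates

end LoopInvariants

end

open LoopInvariants in
theorem mainTheorem7 (K : Type*) [Field K] [IsAlgClosed K] [CharZero K]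
    (q : Type*) [LieRing q] [LieAlgebra K q] [FiniteDimensional K q]
    (F G : SymmetricAlgebra K (LoopInvariants.currentAlg K q))
    (hF : F ∈ LoopInvariants.invariants K q) (hG : G ∈ LoopInvariants.invariants K q) :
    LiePoisson.poissonBracket K (LoopInvariants.currentAlg K q) F G = 0 := by
  let b := Module.finBasis K q
  obtain ⟨N₁, h₁⟩ := exists_derivation_eq_sum b F
  obtain ⟨N₂, h₂⟩ := exists_derivation_eq_sum b G
  let n := max N₁ N₂
  have hF' := h₁ (n + 1) (by omega)
  have hG' := h₂ (n + 1) (by omega)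
  obtain ⟨f, hf, P, hP⟩ := exists_arcMatrix_mul_mul_eq_smul b
  rw [← coeff_dotProduct_arcMatrix b hF' hG']
  -- The form is divisible by `X²ⁿ⁺²`, which covers the coefficient of `X²ⁿ`.
  refine PowerSeries.X_pow_dvd_iff.1 (Matrix.X_pow_dvd_dotProduct_mulVec (m := n + 1) hf hP
    (fun i => ?_) (X_pow_dvd_arcMatrix_mulVec b hG hG')) _ (by omega)
  -- Antisymmetry of the matrix turns the row condition for `F` into the column condition that
  -- invariance provides.
  rw [← Matrix.mulVec_transpose, arcMatrix_transpose, Matrix.neg_mulVec, Pi.neg_apply, dvd_neg]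
  exact X_pow_dvd_arcMatrix_mulVec b hF hF' i
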